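/- **Setting.** A Sprouts position is a finite graph, with vertices of degree at most 3, embedded in a compact boundaryless surface; it is described up to homeomorphism by the graph, by its regions, and by the way these are glued along the graph. Each region is a compact surface with boundary, given by its related closed surface (one of $\mathbb T^n$, the connected sum of $n\ge 0$ tori, with $\mathbb T^0$ the sphere, or $\mathbb P^n$, the connected sum of $n\geq 1$ projective planes) and by its boundaries, each boundary being a closed walk of the graph (possibly an isolated vertex). The direction in which a boundary is run through matters only in a region whose surface is orientable. A vertex of degree $k\le 3$ has $3-k$ lives, and the number of lives of a region is the total number of lives of the vertices touching it. A move draws, inside a region $\mathcal R$ with related surface $\mathcal S$, a line between two vertices with at least one life each (or from a vertex with at least two lives to itself), and puts a new vertex on that line. Either the line links two different boundaries, which are merged, and the surface is unchanged; or it links a boundary to itself, in which case (i) $\mathcal R$ is split into two regions with surfaces $\mathcal S_1,\mathcal S_2$ such that $\mathcal S_1\sharp\mathcal S_2=\mathcal S$, or (ii) $\mathcal R$ is cut along a two-sided non-separating loop ($\mathbb T^n\to\mathbb T^{n-1}$ for $n\ge1$; $\mathbb P^n\to\mathbb P^{n-2}$ for $n\geq 3$; $\mathbb P^{2k}\to\mathbb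 T^{k-1}$ for $k\ge1$), or (iii) $\mathcal R$ is cut along a one-sided loop ($\mathbb P^n\to\mathbb P^{n-1}$ for $n\geq 2$; $\mathbb P^{2k+1}\to\mathbb T^{k}$ for $k\ge0$). The game tree of a position is the rooted tree whose root has as subtrees the game trees of the positions obtained by one move. Two trees are equivalent if the sets of equivalence classes of the subtrees of the children of their roots are equal (recursively). A canonical game tree of a position is a tree with the least number of vertices in the equivalence class of its game tree. **Proposition.** Let $\mathcal P$ be a position and let $\mathcal R$ be a region of $\mathcal P$ with at most 3 lives. 1. If the surface related to $\mathcal R$ is replaced by any other closed surface $\mathbb T^n$ ($n\geq 0$) or $\mathbb P^n$ ($n\geq 1$), the boundaries of $\mathcal R$ and all the other regions being kept (the directions of the boundaries of $\mathcal R$ being chosen arbitrarily if the surface related to $\mathcal R$ was non-orientable), the canonical game tree of the position does not change. 2. If $\mathcal R$ has 0 or 1 life, no move is possible inside $\mathcal R$. 3. If $\mathcal R$ has exactly 2 lives, then whatever its surface is, some move inside $\mathcal R$ is possible, all the moves inside $\mathcal R$ link the same pair of (equal or different) vertices, and all of them lead to positions with the same canonical game tree. 4. If $\mathcal R$ has exactly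 3 lives, then any two moves inside $\mathcal R$ that link the same pair of (equal or different) vertices, whether they split $\mathcal R$ or not, lead to positions with the same canonical game tree. -/

import Mathlib

namespace Sprouts

/-! ## Closed surfaces -/

/-- The connected closed surfaces up to homeomorphism: `T n` is the connected sum of `n` tori
(`T 0` is the sphere) and `P n` is the connected sum of `n ≥ 1` real projective planes. -/
inductive Surface : Type
  | T (n : ℕ) : Surface
  | P (n : ℕ) (hn : 0 < n) : Surface

namespace Surface

def Orientable : Surface → Prop
  | T _ => True
  | P _ _ => False

/-- The connected sum of two closed surfaces. -/
def connectedSum : Surface → Surface → Surface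
  | T m, T n => T (m + n)
  | P m hm, P n _ => P (m + n) (Nat.add_pos_left hm n)
  | P m hm, T n => P (m + 2 * n) (Nat.add_pos_left hm (2 * n))
  | T n, P m hm => P (m + 2 * n) (Nat.add_pos_left hm (2 * n))

/-- `S.BreakHandle S'`: cutting `S` along a two-sided non-separating loop gives `S'`; both are
orientable or both are non-orientable. -/
inductive BreakHandle : Surface → Surface → Prop
  | torus (n : ℕ) : BreakHandle (T (n + 1)) (T n)
  | proj (n : ℕ) (hn : 0 < n) : BreakHandle (P (n + 2) (Nat.add_pos_left hn 2)) (P n hn)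

/-- `S.BreakKlein S'`: cutting the non-orientable `S` along a two-sided non-separating loop gives
the orientable `S'`. -/
inductive BreakKlein : Surface → Surface → Prop
  | mk (k : ℕ) : BreakKlein (P (2 * k + 2) (Nat.succ_pos _)) (T k)

/-- `S.BreakCrosscap S'`: cutting the non-orientable `S` along a one-sided loop gives `S'`. -/
inductive BreakCrosscap : Surface → Surface → Prop
  | proj (n : ℕ) (hn : 0 < n) : BreakCrosscap (P (n + 1) (Nat.succ_pos _)) (P n hn)
  | torus (k : ℕ) : BreakCrosscap (P (2 * k + 1) (Nat.succ_pos _)) (T k)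

end Surface

/-! ## Graphs embedded in surfaces -/

/-- An edge (given by its number) together with one of its two directions. -/
structure Dart where
  edge : ℕ
  forward : Bool
  src : ℕ
  tgt : ℕ

/-- The same edge in the other direction. -/
def Dart.rev (d : Dart) : Dart := ⟨d.edge, !d.forward, d.tgt, d.src⟩

/-- The list of darts `w` is a walk from `u` to `v`. -/
def IsWalk (u : ℕ) : List Dart → ℕ → Prop
  | [], v => u = v
  | d :: w, v => d.src = u ∧ IsWalk d.tgt w v

/-- The walk `w` run through backwards. -/
def revWalk (w : List Dart) : List Dart := (w.map Dart.rev).reverse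

/-- A boundary of a region: the closed walk obtained by turning once around it, starting at one of
its corners. A boundary reduced to an isolated vertex `v` is `⟨v, []⟩`. -/
structure Boundary where
  base : ℕ
  walk : List Dart

namespace Boundary

/-- `b.Reads u w`: started at one of its corners, located at the vertex `u`, the boundary `b` reads
as the closed walk `w`. -/
def Reads (b : Boundary) (u : ℕ) (w : List Dart) : Prop :=
  ∃ x y : List Dart, b.walk = x ++ y ∧ w = y ++ x ∧ IsWalk b.base x u

/-- The boundary run through in the other direction. -/
def reverse (b : Boundary) : Boundary := ⟨b.base, revWalk b.walk⟩

/-- The vertices met along the boundary. -/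
def vertices (b : Boundary) : Multiset ℕ := ↑(b.base :: b.walk.map Dart.src)

end Boundary

/-- A region: its related closed surface (the region is this surface with one open disc removed
for each boundary), and its boundaries. If the surface is orientable, all the boundaries are run
through coherently with one orientation of the region. If it is not, the direction in which a
boundary is run through carries no information. -/
structure Region where
  surface : Surface
  boundaries : Multiset Boundary

/-- The set of vertices touching the region. -/
def Region.vertices (R : Region) : Finset ℕ := (R.boundaries.bind Boundary.vertices).toFinset

/-- `Reorient S bs cs`: `cs` is obtained from `bs` by choosing anew the directions of the
boundaries, which is possible in a region whose related surface `S` is non-orientable. -/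
def Reorient (S : Surface) (bs cs : Multiset Boundary) : Prop :=
  Multiset.Rel (fun b c => c = b ∨ (¬ S.Orientable ∧ c = b.reverse)) bs cs

/-- The data of a graph drawn on a surface. The vertices are `0, …, numVertices - 1`. The `k`-th
entry `(a, b)` of `edges` says that the edge number `k` joins `a` and `b`, and is directed forward
from `a` to `b`. The surface is obtained by glueing the regions along the graph. -/
structure Position where
  numVertices : ℕ
  edges : List (ℕ × ℕ)
  regions : Multiset Region

namespace Position

/-- The number of edge ends at the vertex `v` (a loop counts twice). -/
def degree (G : Position) (v : ℕ) : ℕ :=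
  (G.edges.map Prod.fst).count v + (G.edges.map Prod.snd).count v

/-- The number of lives of a vertex. -/
def lives (G : Position) (v : ℕ) : ℕ := 3 - G.degree v

/-- The number of lives of a region: the total number of lives of the vertices touching it. -/
def regionLives (G : Position) (R : Region) : ℕ := ∑ v ∈ R.vertices, G.lives v

/-- The total number of lives of the position. -/
def totalLives (G : Position) : ℕ := ∑ v ∈ Finset.range G.numVertices, G.lives v

/-- `d` is one of the two darts of an edge of the graph. -/
def HasDart (G : Position) (d : Dart) : Prop :=
  G.edges[d.edge]? = some (if d.forward then (d.src, d.tgt) else (d.tgt, d.src))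

/-- All the boundaries of all the regions. -/
def allBoundaries (G : Position) : Multiset Boundary := G.regions.bind Region.boundaries

/-- `x` and `y`, directed away from their common source, bound a corner of some region: some
boundary arrives along `x` and leaves along `y`. -/
def Corner (G : Position) (x y : Dart) : Prop :=
  ∃ b ∈ G.allBoundaries, [x.rev, y] <:+: b.walk ++ b.walk.take 1

/-- The data do describe a graph embedded in a compact surface, with vertices of degree at most
three, cut by the graph into the given regions. -/
structure IsEmbedded (G : Position) : Prop where
  edges_lt : ∀ e ∈ G.edges, e.1 < G.numVertices ∧ e.2 < G.numVertices
  degree_le : ∀ v < G.numVertices, G.degree v ≤ 3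
  base_lt : ∀ b ∈ G.allBoundaries, b.base < G.numVertices
  /-- The boundaries are closed walks of the graph. -/
  hasDart : ∀ b ∈ G.allBoundaries, ∀ d ∈ b.walk, G.HasDart d
  isWalk : ∀ b ∈ G.allBoundaries, IsWalk b.base b.walk b.base
  /-- Each edge has two sides, and each of them is on one boundary of one region. -/
  two_sides : ∀ k < G.edges.length,
    (G.allBoundaries.bind fun b => (↑(b.walk.map Dart.edge) : Multiset ℕ)).count k = 2
  /-- The boundaries reduced to a vertex are the isolated vertices, each of them once. -/
  isolated : ∀ v < G.numVertices,
    ((G.allBoundaries.bind fun b => if b.walk.isEmpty then {b.base} else 0) : Multiset ℕ).count v =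
      if G.degree v = 0 then 1 else 0
  /-- The surface is not pinched at a vertex: the corners there form one cycle. -/
  link : ∀ x y : Dart, G.HasDart x → G.HasDart y → x.src = y.src → Relation.EqvGen G.Corner x y

end Position

/-! ## Moves -/

/-- The line drawn from `u` to `v`, with a new vertex `c` on it, which makes it consist of the two
new edges number `m` and `m + 1`. -/
def newLine (c m u v : ℕ) : List Dart := [⟨m, true, u, c⟩, ⟨m + 1, true, c, v⟩]

/-- `RegionMove c m u v R Rs`: a line drawn inside the region `R` from the vertex `u` to the vertex
`v`, with the new vertex `c` on it and the new edges `m` and `m + 1`, turns `R` into the one or two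
regions `Rs`. -/
inductive RegionMove (c m u v : ℕ) : Region → Multiset Region → Prop
  /-- Two different boundaries are linked (kind I). -/
  | link (S : Surface) (b₁ b₂ : Boundary) (bs : Multiset Boundary) (w₁ w₂ : List Dart)
      (h₁ : b₁.Reads u w₁) (h₂ : b₂.Reads v w₂) :
      RegionMove c m u v ⟨S, b₁ ::ₘ b₂ ::ₘ bs⟩
        {⟨S, ⟨u, w₁ ++ newLine c m u v ++ w₂ ++ revWalk (newLine c m u v)⟩ ::ₘ bs⟩}
  /-- Two different boundaries are linked (kind I), and the line reverses the direction of the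
  second one with respect to the first one. -/
  | linkRev (S : Surface) (hS : ¬ S.Orientable) (b₁ b₂ : Boundary) (bs : Multiset Boundary)
      (w₁ w₂ : List Dart) (h₁ : b₁.Reads u w₁) (h₂ : b₂.Reads v w₂) :
      RegionMove c m u v ⟨S, b₁ ::ₘ b₂ ::ₘ bs⟩
        {⟨S, ⟨u, w₁ ++ newLine c m u v ++ revWalk w₂ ++ revWalk (newLine c m u v)⟩ ::ₘ bs⟩}
  /-- A boundary is linked to itself and the region is split (kind II.A). The surface of the region
  is the connected sum of those of the two pieces, among which the other boundaries are shared. -/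
  | split (S S₁ S₂ : Surface) (hS : S₁.connectedSum S₂ = S) (b : Boundary)
      (bs₁ bs₂ cs₁ cs₂ : Multiset Boundary) (w₁ w₂ : List Dart)
      (h : b.Reads u (w₁ ++ w₂)) (hw : IsWalk u w₁ v)
      (hc₁ : Reorient S bs₁ cs₁) (hc₂ : Reorient S bs₂ cs₂) :
      RegionMove c m u v ⟨S, b ::ₘ (bs₁ + bs₂)⟩
        {⟨S₁, ⟨u, w₁ ++ revWalk (newLine c m u v)⟩ ::ₘ cs₁⟩,
          ⟨S₂, ⟨v, w₂ ++ newLine c m u v⟩ ::ₘ cs₂⟩}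
  /-- A boundary is linked to itself, and a handle is broken (kinds II.B.1.a and II.B.1.b). -/
  | breakHandle (S S' : Surface) (hS : S.BreakHandle S') (b : Boundary)
      (bs cs : Multiset Boundary) (w₁ w₂ : List Dart)
      (h : b.Reads u (w₁ ++ w₂)) (hw : IsWalk u w₁ v) (hc : Reorient S bs cs) :
      RegionMove c m u v ⟨S, b ::ₘ bs⟩
        {⟨S', ⟨u, w₁ ++ revWalk (newLine c m u v)⟩ ::ₘ ⟨v, w₂ ++ newLine c m u v⟩ ::ₘ cs⟩}
  /-- A boundary is linked to itself, and the neck of a Klein bottle is broken in such a way that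
  the region becomes orientable (kind II.B.1.c). -/
  | breakKlein (S S' : Surface) (hS : S.BreakKlein S') (b : Boundary)
      (bs cs : Multiset Boundary) (w₁ w₂ : List Dart)
      (h : b.Reads u (w₁ ++ w₂)) (hw : IsWalk u w₁ v) (hc : Reorient S bs cs) :
      RegionMove c m u v ⟨S, b ::ₘ bs⟩
        {⟨S', ⟨u, newLine c m u v ++ revWalk w₁⟩ ::ₘ ⟨v, w₂ ++ newLine c m u v⟩ ::ₘ cs⟩}
  /-- A boundary is linked to itself, and a projective plane is broken (kind II.B.2). -/
  | breakCrosscap (S S' : Surface) (hS : S.BreakCrosscap S') (b : Boundary)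
      (bs cs : Multiset Boundary) (w₁ w₂ : List Dart)
      (h : b.Reads u (w₁ ++ w₂)) (hw : IsWalk u w₁ v) (hc : Reorient S bs cs) :
      RegionMove c m u v ⟨S, b ::ₘ bs⟩
        {⟨S', ⟨v, w₂ ++ newLine c m u v ++ revWalk w₁ ++ newLine c m u v⟩ ::ₘ cs⟩}

namespace Position

/-- The vertices `u` and `v` have enough lives to be linked by a line. -/
def CanLink (G : Position) (u v : ℕ) : Prop :=
  u < G.numVertices ∧ v < G.numVertices ∧ 1 ≤ G.lives u ∧ 1 ≤ G.lives v ∧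
    (u = v → 2 ≤ G.lives u)

/-- `G.MoveIn R u v H`: the position `H` is obtained from `G` by a move inside the region `R` which
links the vertices `u` and `v`. -/
def MoveIn (G : Position) (R : Region) (u v : ℕ) (H : Position) : Prop :=
  ∃ rest new : Multiset Region, G.regions = R ::ₘ rest ∧ G.CanLink u v ∧
    RegionMove G.numVertices G.edges.length u v R new ∧
    H = ⟨G.numVertices + 1, G.edges ++ [(u, G.numVertices), (G.numVertices, v)], new + rest⟩

/-- `H` is obtained from `G` by one move. -/
def Move (G H : Position) : Prop := ∃ R u v, G.MoveIn R u v H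

theorem Move.totalLives_lt {G H : Position} (h : G.Move H) : H.totalLives < G.totalLives := by
  obtain ⟨R, u, v, rest, new, -, ⟨hu, hv, hlu, hlv, huv⟩, -, rfl⟩ := h
  have key : ∀ w, (3 - ((if u = w then 1 else 0) + (if v = w then 1 else 0) +
      (if G.numVertices = w then 2 else 0) + G.degree w)) =
      Position.lives ⟨G.numVertices + 1,
        G.edges ++ [(u, G.numVertices), (G.numVertices, v)], new + rest⟩ w := by
    intro w
    simp only [lives, degree, List.map_append, List.count_append, List.map_cons, List.map_nil,
      List.count_cons, List.count_nil, beq_iff_eq]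
    split_ifs <;> omega
  have hsum : ∀ w ∈ Finset.range G.numVertices, Position.lives ⟨G.numVertices + 1,
        G.edges ++ [(u, G.numVertices), (G.numVertices, v)], new + rest⟩ w +
        ((if u = w then 1 else 0) + (if v = w then 1 else 0)) = G.lives w := by
    intro w hw
    have hw' := Finset.mem_range.1 hw
    rw [← key]
    unfold lives at *
    by_cases h1 : u = w <;> by_cases h2 : v = w
    · have := huv (h1.trans h2.symm)
      subst h1
      simp only [h2, if_true, if_neg (show ¬ G.numVertices = u by omega)]
      omega
    · subst h1
      simp only [h2, if_true, if_false, if_neg (show ¬ G.numVertices = u by omega)]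
      omega
    · subst h2
      simp only [h1, if_true, if_false, if_neg (show ¬ G.numVertices = v by omega)]
      omega
    · simp only [h1, h2, if_false, if_neg (show ¬ G.numVertices = w by omega)]
      omega
  have h3 := Finset.sum_congr rfl hsum
  rw [Finset.sum_add_distrib, Finset.sum_add_distrib, Finset.sum_ite_eq, Finset.sum_ite_eq,
    if_pos (Finset.mem_range.2 hu), if_pos (Finset.mem_range.2 hv)] at h3
  have h4 := key G.numVertices
  simp only [if_true] at h4
  have h5 : G.totalLives = ∑ w ∈ Finset.range G.numVertices, G.lives w := rfl
  rw [h5, ← h3]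
  unfold totalLives
  rw [Finset.sum_range_succ]
  omega

end Position

/-! ## Game trees -/

/-- Rooted trees, given by the family of the subtrees of the children of the root. -/
inductive GameTree : Type 1
  | node (ι : Type) (child : ι → GameTree) : GameTree

namespace GameTree

/-- Two trees are equivalent if the sets of equivalence classes of the subtrees of the children of
their roots are equal. -/
def Equivalent : GameTree → GameTree → Prop
  | node _ f, node _ g =>
    (∀ i, ∃ j, Equivalent (f i) (g j)) ∧ (∀ j, ∃ i, Equivalent (f i) (g j))

/-- The number of vertices of a tree. -/
noncomputable def numVertices : GameTree → Cardinal.{0}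
  | node _ f => 1 + Cardinal.sum fun i => numVertices (f i)

/-- `T` has the least number of vertices in the equivalence class of the tree `A`. -/
def IsCanonical (T A : GameTree) : Prop :=
  T.Equivalent A ∧ ∀ T' : GameTree, T'.Equivalent A → T.numVertices ≤ T'.numVertices

end GameTree

namespace Position

/-- The game tree obtained from a position. -/
def gameTree (G : Position) : GameTree :=
  GameTree.node {H : Position // G.Move H} fun H => gameTree H.1
termination_by G.totalLives
decreasing_by exact Move.totalLives_lt H.2

/-- The canonical game trees obtained from `G` and `H` are the same: the one of `G` exists, and a
tree is a canonical game tree for `G` if and only if it is one for `H`. -/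
def SameCanonicalTree (G H : Position) : Prop :=
  (∃ T : GameTree, T.IsCanonical G.gameTree) ∧
    ∀ T : GameTree, T.IsCanonical G.gameTree ↔ T.IsCanonical H.gameTree

end Position

end Sprouts

namespace Sprouts

/-! ## Walks -/

/-! The surface of a region never decides whether two of its vertices can be linked: if they lie on
different boundaries these can be merged, and if they lie on one boundary a sphere can be split off,
since `T 0` is neutral for the connected sum (`exists_regionMove`). What a move may change is which
live vertices still share a region. With at most three lives nothing is lost. A line consumes two
lives and its new vertex brings at most one, so the old vertices keep at most one life; if two
distinct live vertices remain, one of them is the new vertex, which touches every piece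
(`RegionMove.moveVertices`). A split therefore cannot separate them.

This invariant is `Tame`: few lives, and any two live vertices of the family have a common region.
It survives moves inside the family (`Tame.move`) and outside it (`Tame.addLine`). Two positions
that agree except for tame families touched by the same vertices are `Similar`. A move in one is
answered in the other by a line between the same vertices, so `Similar` is a bisimulation
(`Similar.exists_move`). The game trees are then equivalent, and equivalent trees have the same
canonical trees. -/

theorem IsWalk.end_unique {u v v' : ℕ} {w : List Dart} (h : IsWalk u w v) (h' : IsWalk u w v') :
    v = v' := by
  induction w generalizing u with
  | nil => exact h.symm.trans h'
  | cons d w ih => exact ih h.2 h'.2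

theorem isWalk_append {u v : ℕ} {w w' : List Dart} :
    IsWalk u (w ++ w') v ↔ ∃ m, IsWalk u w m ∧ IsWalk m w' v := by
  induction w generalizing u with
  | nil => simp [IsWalk]
  | cons d w ih => simp [IsWalk, ih, and_assoc]

theorem IsWalk.append {u m v : ℕ} {w w' : List Dart} (h : IsWalk u w m) (h' : IsWalk m w' v) :
    IsWalk u (w ++ w') v :=
  isWalk_append.2 ⟨m, h, h'⟩

theorem revWalk_cons (d : Dart) (w : List Dart) : revWalk (d :: w) = revWalk w ++ [d.rev] := by
  simp [revWalk]

theorem IsWalk.revWalk {u v : ℕ} {w : List Dart} (h : IsWalk u w v) :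
    IsWalk v (revWalk w) u := by
  induction w generalizing u with
  | nil => exact Eq.symm h
  | cons d w ih =>
    rw [revWalk_cons]
    exact (ih h.2).append ⟨rfl, h.1⟩

theorem isWalk_newLine (c m u v : ℕ) : IsWalk u (newLine c m u v) v := ⟨rfl, rfl, rfl⟩

/-- `Passes u w x`: the walk `w` with origin `u` passes through the vertex `x`, possibly at one of
its ends. -/
def Passes (u : ℕ) : List Dart → ℕ → Prop
  | [], x => x = u
  | d :: w, x => x = u ∨ Passes d.tgt w x

theorem passes_start (u : ℕ) (w : List Dart) : Passes u w u := by
  cases w <;> simp [Passes]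

theorem passes_append {u v : ℕ} {w : List Dart} (h : IsWalk u w v) (w' : List Dart) (x : ℕ) :
    Passes u (w ++ w') x ↔ Passes u w x ∨ Passes v w' x := by
  induction w generalizing u with
  | nil =>
    obtain rfl : u = v := h
    refine ⟨Or.inr, fun h => h.elim (fun h => ?_) id⟩
    obtain rfl : x = u := h
    exact passes_start _ _
  | cons d w ih => simp [Passes, ih h.2, or_assoc]

theorem passes_revWalk {u v : ℕ} {w : List Dart} (h : IsWalk u w v) (x : ℕ) :
    Passes v (revWalk w) x ↔ Passes u w x := by
  induction w generalizing u with
  | nil =>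
    obtain rfl : u = v := h
    rfl
  | cons d w ih =>
    obtain ⟨rfl, h⟩ := h
    rw [revWalk_cons, passes_append h.revWalk, ih h]
    -- Reversal puts `d.tgt` at the junction of the two pieces; it is already counted as the start
    -- of `w`.
    have h₀ := passes_start d.tgt w
    simp only [Passes, Dart.rev]
    constructor
    · rintro (h | rfl | h) <;> tauto
    · rintro (rfl | h) <;> tauto

theorem passes_iff {u v : ℕ} {w : List Dart} (h : IsWalk u w v) (x : ℕ) :
    Passes u w x ↔ x ∈ w.map Dart.src ∨ x = v := by
  induction w generalizing u with
  | nil => simp [Passes, show u = v from h]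
  | cons d w ih => simp [Passes, ih h.2, ← h.1, or_assoc]

theorem exists_split_of_passes {u v x : ℕ} {w : List Dart} (h : IsWalk u w v)
    (hx : Passes u w x) : ∃ w₁ w₂, w = w₁ ++ w₂ ∧ IsWalk u w₁ x ∧ IsWalk x w₂ v := by
  induction w generalizing u with
  | nil =>
    obtain rfl : x = u := hx
    exact ⟨[], [], rfl, rfl, h⟩
  | cons d w ih =>
    rcases hx with rfl | hx
    · exact ⟨[], d :: w, rfl, rfl, h⟩
    · obtain ⟨w₁, w₂, rfl, h₁, h₂⟩ := ih h.2 hx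
      exact ⟨d :: w₁, w₂, rfl, ⟨h.1, h₁⟩, h₂⟩

theorem passes_newLine (c m u v x : ℕ) :
    Passes u (newLine c m u v) x ↔ x = u ∨ x = c ∨ x = v := Iff.rfl

theorem passes_revWalk_newLine (c m u v x : ℕ) :
    Passes v (revWalk (newLine c m u v)) x ↔ x = u ∨ x = c ∨ x = v :=
  passes_revWalk (isWalk_newLine c m u v) x

/-! ## Boundaries -/

/-- The walk of the boundary is a closed walk from its base. -/
def Boundary.Closed (b : Boundary) : Prop := IsWalk b.base b.walk b.base

theorem Boundary.Closed.mem_vertices {b : Boundary} (h : b.Closed) (x : ℕ) :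
    x ∈ b.vertices ↔ Passes b.base b.walk x := by
  rw [passes_iff h]
  simp [Boundary.vertices, or_comm]

theorem Boundary.Closed.reverse {b : Boundary} (h : b.Closed) : b.reverse.Closed :=
  IsWalk.revWalk h

theorem Boundary.Closed.mem_vertices_reverse {b : Boundary} (h : b.Closed) (x : ℕ) :
    x ∈ b.reverse.vertices ↔ x ∈ b.vertices := by
  rw [h.reverse.mem_vertices, h.mem_vertices]
  exact passes_revWalk h x

theorem Boundary.Closed.reads {b : Boundary} (hb : b.Closed) {u : ℕ} {w : List Dart}
    (h : b.Reads u w) : IsWalk u w u ∧ ∀ x, x ∈ b.vertices ↔ Passes u w x := by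
  obtain ⟨p, q, hpq, rfl, hp⟩ := h
  have hc : IsWalk b.base (p ++ q) b.base := hpq ▸ hb
  obtain ⟨m, hp', hq⟩ := isWalk_append.1 hc
  obtain rfl := hp.end_unique hp'
  refine ⟨hq.append hp, fun x => ?_⟩
  rw [hb.mem_vertices, hpq, passes_append hp, passes_append hq, or_comm]

theorem Boundary.Closed.exists_reads {b : Boundary} (hb : b.Closed) {u : ℕ}
    (hu : u ∈ b.vertices) : ∃ w, b.Reads u w := by
  obtain ⟨p, q, hpq, hp, -⟩ := exists_split_of_passes hb ((hb.mem_vertices u).1 hu)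
  exact ⟨q ++ p, p, q, hpq, rfl, hp⟩

/-! ## Regions -/

theorem Region.mem_vertices {R : Region} {x : ℕ} :
    x ∈ R.vertices ↔ ∃ b ∈ R.boundaries, x ∈ b.vertices := by
  simp [Region.vertices]

/-- All the boundaries of the region are closed walks. -/
def Region.Closed (R : Region) : Prop := ∀ b ∈ R.boundaries, b.Closed

theorem Reorient.refl (S : Surface) (bs : Multiset Boundary) : Reorient S bs bs :=
  Multiset.rel_refl_of_refl_on fun _ _ => Or.inl rfl

theorem Reorient.closed {S : Surface} {bs cs : Multiset Boundary} (h : Reorient S bs cs)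
    (hb : ∀ b ∈ bs, b.Closed) : ∀ c ∈ cs, c.Closed := by
  intro c hc
  obtain ⟨b, hbm, rfl | ⟨-, rfl⟩⟩ := Multiset.exists_mem_of_rel_of_mem (Multiset.rel_flip.2 h) hc
  · exact hb _ hbm
  · exact (hb _ hbm).reverse

theorem Reorient.mem_vertices {S : Surface} {bs cs : Multiset Boundary} (h : Reorient S bs cs)
    (hb : ∀ b ∈ bs, b.Closed) (x : ℕ) :
    (∃ c ∈ cs, x ∈ c.vertices) ↔ ∃ b ∈ bs, x ∈ b.vertices := by
  constructor
  · rintro ⟨c, hc, hx⟩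
    obtain ⟨b, hbm, rfl | ⟨-, rfl⟩⟩ :=
      Multiset.exists_mem_of_rel_of_mem (Multiset.rel_flip.2 h) hc
    · exact ⟨_, hbm, hx⟩
    · exact ⟨b, hbm, ((hb b hbm).mem_vertices_reverse x).1 hx⟩
  · rintro ⟨b, hbm, hx⟩
    obtain ⟨c, hc, rfl | ⟨-, rfl⟩⟩ := Multiset.exists_mem_of_rel_of_mem h hbm
    · exact ⟨_, hc, hx⟩
    · exact ⟨_, hc, ((hb b hbm).mem_vertices_reverse x).2 hx⟩

/-- The vertices touching some region of the family `F`. -/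
def familyVertices (F : Multiset Region) : Finset ℕ := (F.bind fun R => R.vertices.val).toFinset

theorem mem_familyVertices {F : Multiset Region} {x : ℕ} :
    x ∈ familyVertices F ↔ ∃ R ∈ F, x ∈ R.vertices := by
  simp [familyVertices]

theorem mem_familyVertices_cons {R : Region} {F : Multiset Region} {x : ℕ} :
    x ∈ familyVertices (R ::ₘ F) ↔ x ∈ R.vertices ∨ x ∈ familyVertices F := by
  simp [mem_familyVertices]

theorem mem_familyVertices_add {F F' : Multiset Region} {x : ℕ} :
    x ∈ familyVertices (F + F') ↔ x ∈ familyVertices F ∨ x ∈ familyVertices F' := by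
  simp [mem_familyVertices, or_and_right, exists_or]

theorem familyVertices_singleton (R : Region) : familyVertices {R} = R.vertices := by
  ext x
  simp [mem_familyVertices]

/-! ### Effect of a line on the vertices touching a region -/

/-- What a move inside a region `R` with closed boundaries does to the vertices: the new regions
have closed boundaries, they all touch the new vertex `c`, and besides `c` they touch together the
same vertices as `R`. -/
structure MoveVertices (c u v : ℕ) (R : Region) (Rs : Multiset Region) : Prop where
  closed : ∀ R' ∈ Rs, R'.Closed
  mem_iff : ∀ x, x ∈ familyVertices Rs ↔ x = c ∨ x ∈ R.vertices
  new_mem : ∀ R' ∈ Rs, c ∈ R'.vertices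
  src_mem : u ∈ R.vertices
  tgt_mem : v ∈ R.vertices

theorem Region.vertices_cons {S : Surface} {b : Boundary} {bs : Multiset Boundary} {x : ℕ} :
    x ∈ Region.vertices ⟨S, b ::ₘ bs⟩ ↔ x ∈ b.vertices ∨ ∃ b' ∈ bs, x ∈ b'.vertices := by
  simp [Region.mem_vertices]

theorem mem_vertices_mk {u x : ℕ} {w : List Dart} (h : IsWalk u w u) :
    x ∈ Boundary.vertices ⟨u, w⟩ ↔ Passes u w x :=
  Boundary.Closed.mem_vertices (b := ⟨u, w⟩) h x

theorem Region.closed_cons {S : Surface} {b : Boundary} {bs : Multiset Boundary} :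
    Region.Closed ⟨S, b ::ₘ bs⟩ ↔ b.Closed ∧ ∀ b' ∈ bs, b'.Closed := by
  simp [Region.Closed]

theorem MoveVertices.singleton {c u v : ℕ} {R R' : Region} (hc : R'.Closed)
    (hm : ∀ x, x ∈ R'.vertices ↔ x = c ∨ x ∈ R.vertices) (hu : u ∈ R.vertices)
    (hv : v ∈ R.vertices) : MoveVertices c u v R {R'} where
  closed := by simpa using hc
  mem_iff := by simpa [familyVertices_singleton] using hm
  new_mem := by simp [hm]
  src_mem := hu
  tgt_mem := hv

/-- Every kind of move glues pieces of old boundary walks, possibly rotated or reversed, with copies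
of the new line. The set of vertices passed ignores order and direction, so all six kinds give the
same result. The bisimulation needs nothing else about a move. -/
theorem RegionMove.moveVertices {c m u v : ℕ} {R : Region} {Rs : Multiset Region}
    (h : RegionMove c m u v R Rs) (hR : R.Closed) : MoveVertices c u v R Rs := by
  have hl := isWalk_newLine c m u v
  have pl := passes_newLine c m u v
  have pr := passes_revWalk_newLine c m u v
  cases h with
  | link S b₁ b₂ bs w₁ w₂ h₁ h₂ =>
    simp only [Region.closed_cons, Multiset.mem_cons, forall_eq_or_imp] at hR
    obtain ⟨c₁, v₁⟩ := hR.1.reads h₁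
    obtain ⟨c₂, v₂⟩ := hR.2.1.reads h₂
    -- The new line also passes through `u` and `v`; `p₁` and `p₂` say that these are not additional
    -- vertices.
    have p₁ := passes_start u w₁
    have p₂ := passes_start v w₂
    have hw := ((c₁.append hl).append c₂).append hl.revWalk
    have hm : ∀ x, x ∈ Region.vertices ⟨S, ⟨u, w₁ ++ newLine c m u v ++ w₂ ++
        revWalk (newLine c m u v)⟩ ::ₘ bs⟩ ↔
        x = c ∨ x ∈ Region.vertices ⟨S, b₁ ::ₘ b₂ ::ₘ bs⟩ := by
      intro x
      simp only [Region.vertices_cons, Multiset.mem_cons, exists_eq_or_imp, mem_vertices_mk hw,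
        passes_append ((c₁.append hl).append c₂), passes_append (c₁.append hl), passes_append c₁,
        pl, pr, v₁, v₂]
      grind
    exact .singleton (Region.closed_cons.2 ⟨hw, hR.2.2⟩) hm
      (Region.vertices_cons.2 (Or.inl ((v₁ u).2 p₁)))
      (Region.mem_vertices.2 ⟨b₂, by simp, (v₂ v).2 p₂⟩)
  | linkRev S hS b₁ b₂ bs w₁ w₂ h₁ h₂ =>
    simp only [Region.closed_cons, Multiset.mem_cons, forall_eq_or_imp] at hR
    obtain ⟨c₁, v₁⟩ := hR.1.reads h₁
    obtain ⟨c₂, v₂⟩ := hR.2.1.reads h₂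
    have p₁ := passes_start u w₁
    have p₂ := passes_start v w₂
    have hw := ((c₁.append hl).append c₂.revWalk).append hl.revWalk
    have hm : ∀ x, x ∈ Region.vertices ⟨S, ⟨u, w₁ ++ newLine c m u v ++ revWalk w₂ ++
        revWalk (newLine c m u v)⟩ ::ₘ bs⟩ ↔
        x = c ∨ x ∈ Region.vertices ⟨S, b₁ ::ₘ b₂ ::ₘ bs⟩ := by
      intro x
      simp only [Region.vertices_cons, Multiset.mem_cons, exists_eq_or_imp, mem_vertices_mk hw,
        passes_append ((c₁.append hl).append c₂.revWalk), passes_append (c₁.append hl),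
        passes_append c₁, passes_revWalk c₂, pl, pr, v₁, v₂]
      grind
    exact .singleton (Region.closed_cons.2 ⟨hw, hR.2.2⟩) hm
      (Region.vertices_cons.2 (Or.inl ((v₁ u).2 p₁)))
      (Region.mem_vertices.2 ⟨b₂, by simp, (v₂ v).2 p₂⟩)
  | split S S₁ S₂ hS b bs₁ bs₂ cs₁ cs₂ w₁ w₂ h h₁ hc₁ hc₂ =>
    simp only [Region.closed_cons, Multiset.mem_add, or_imp, forall_and] at hR
    obtain ⟨c₀, v₀⟩ := hR.1.reads h
    obtain ⟨v', h₁', h₂⟩ := isWalk_append.1 c₀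
    -- The closed walk `w₁ ++ w₂` is cut at some vertex `v'`; since `w₁` ends at `v`, this vertex is
    -- `v`.
    obtain rfl := h₁.end_unique h₁'
    have p₁ := passes_start u w₁
    have p₂ := passes_start v w₂
    have k₁ := h₁.append hl.revWalk
    have k₂ := h₂.append hl
    have hm₁ : ∀ x, x ∈ Region.vertices ⟨S₁, ⟨u, w₁ ++ revWalk (newLine c m u v)⟩ ::ₘ cs₁⟩ ↔
        (Passes u w₁ x ∨ x = u ∨ x = c ∨ x = v) ∨ ∃ b' ∈ bs₁, x ∈ b'.vertices := by
      intro x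
      rw [Region.vertices_cons, mem_vertices_mk k₁, passes_append h₁, pr,
        hc₁.mem_vertices hR.2.1]
    have hm₂ : ∀ x, x ∈ Region.vertices ⟨S₂, ⟨v, w₂ ++ newLine c m u v⟩ ::ₘ cs₂⟩ ↔
        (Passes v w₂ x ∨ x = u ∨ x = c ∨ x = v) ∨ ∃ b' ∈ bs₂, x ∈ b'.vertices := by
      intro x
      rw [Region.vertices_cons, mem_vertices_mk k₂, passes_append h₂, pl,
        hc₂.mem_vertices hR.2.2]
    refine ⟨?_, ?_, ?_, ?_, ?_⟩
    · simpa [Region.closed_cons] using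
        ⟨⟨k₁, hc₁.closed hR.2.1⟩, k₂, hc₂.closed hR.2.2⟩
    · intro x
      simp only [mem_familyVertices, Multiset.insert_eq_cons, Multiset.mem_cons,
        Multiset.mem_singleton, exists_eq_left, hm₁, hm₂, Region.vertices_cons,
        Multiset.mem_add, or_and_right, exists_or, v₀, passes_append h₁]
      grind
    · simp [hm₁, hm₂]
    · exact Region.vertices_cons.2 (Or.inl ((v₀ u).2 (passes_start _ _)))
    · exact Region.vertices_cons.2 (Or.inl ((v₀ v).2 ((passes_append h₁ _ _).2 (Or.inr p₂))))
  | breakHandle S S' hS b bs cs w₁ w₂ h h₁ hc =>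
    simp only [Region.closed_cons] at hR
    obtain ⟨c₀, v₀⟩ := hR.1.reads h
    obtain ⟨v', h₁', h₂⟩ := isWalk_append.1 c₀
    obtain rfl := h₁.end_unique h₁'
    have p₁ := passes_start u w₁
    have p₂ := passes_start v w₂
    have k₁ := h₁.append hl.revWalk
    have k₂ := h₂.append hl
    have hm : ∀ x, x ∈ Region.vertices ⟨S', ⟨u, w₁ ++ revWalk (newLine c m u v)⟩ ::ₘ
        ⟨v, w₂ ++ newLine c m u v⟩ ::ₘ cs⟩ ↔ x = c ∨ x ∈ Region.vertices ⟨S, b ::ₘ bs⟩ := by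
      intro x
      simp only [Region.vertices_cons, Multiset.mem_cons, exists_eq_or_imp, mem_vertices_mk k₁,
        mem_vertices_mk k₂, passes_append h₁, passes_append h₂, pl, pr, v₀,
        hc.mem_vertices hR.2]
      grind
    exact .singleton (Region.closed_cons.2 ⟨k₁, Multiset.forall_mem_cons.2 ⟨k₂, hc.closed hR.2⟩⟩) hm
      (Region.vertices_cons.2 (Or.inl ((v₀ u).2 (passes_start _ _))))
      (Region.vertices_cons.2 (Or.inl ((v₀ v).2 ((passes_append h₁ _ _).2 (Or.inr p₂)))))
  | breakKlein S S' hS b bs cs w₁ w₂ h h₁ hc =>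
    simp only [Region.closed_cons] at hR
    obtain ⟨c₀, v₀⟩ := hR.1.reads h
    obtain ⟨v', h₁', h₂⟩ := isWalk_append.1 c₀
    obtain rfl := h₁.end_unique h₁'
    have p₁ := passes_start u w₁
    have p₂ := passes_start v w₂
    have k₁ := hl.append h₁.revWalk
    have k₂ := h₂.append hl
    have hm : ∀ x, x ∈ Region.vertices ⟨S', ⟨u, newLine c m u v ++ revWalk w₁⟩ ::ₘ
        ⟨v, w₂ ++ newLine c m u v⟩ ::ₘ cs⟩ ↔ x = c ∨ x ∈ Region.vertices ⟨S, b ::ₘ bs⟩ := by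
      intro x
      simp only [Region.vertices_cons, Multiset.mem_cons, exists_eq_or_imp, mem_vertices_mk k₁,
        mem_vertices_mk k₂, passes_append hl, passes_append h₁, passes_append h₂,
        passes_revWalk h₁, pl, v₀, hc.mem_vertices hR.2]
      grind
    exact .singleton (Region.closed_cons.2 ⟨k₁, Multiset.forall_mem_cons.2 ⟨k₂, hc.closed hR.2⟩⟩) hm
      (Region.vertices_cons.2 (Or.inl ((v₀ u).2 (passes_start _ _))))
      (Region.vertices_cons.2 (Or.inl ((v₀ v).2 ((passes_append h₁ _ _).2 (Or.inr p₂)))))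
  | breakCrosscap S S' hS b bs cs w₁ w₂ h h₁ hc =>
    simp only [Region.closed_cons] at hR
    obtain ⟨c₀, v₀⟩ := hR.1.reads h
    obtain ⟨v', h₁', h₂⟩ := isWalk_append.1 c₀
    obtain rfl := h₁.end_unique h₁'
    have p₁ := passes_start u w₁
    have p₂ := passes_start v w₂
    have k := ((h₂.append hl).append h₁.revWalk).append hl
    have hm : ∀ x, x ∈ Region.vertices ⟨S', ⟨v, w₂ ++ newLine c m u v ++ revWalk w₁ ++
        newLine c m u v⟩ ::ₘ cs⟩ ↔ x = c ∨ x ∈ Region.vertices ⟨S, b ::ₘ bs⟩ := by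
      intro x
      simp only [Region.vertices_cons, mem_vertices_mk k,
        passes_append ((h₂.append hl).append h₁.revWalk), passes_append (h₂.append hl),
        passes_append h₁, passes_append h₂, passes_revWalk h₁, pl, v₀, hc.mem_vertices hR.2]
      grind
    exact .singleton (Region.closed_cons.2 ⟨k, hc.closed hR.2⟩) hm
      (Region.vertices_cons.2 (Or.inl ((v₀ u).2 (passes_start _ _))))
      (Region.vertices_cons.2 (Or.inl ((v₀ v).2 ((passes_append h₁ _ _).2 (Or.inr p₂)))))

theorem Surface.sphere_connectedSum (S : Surface) : (Surface.T 0).connectedSum S = S := by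
  cases S <;> simp [Surface.connectedSum]

/-- Inside a region with closed boundaries, whatever its surface is, any two vertices (equal or
different) can be linked by a line. -/
theorem exists_regionMove (c m : ℕ) {u v : ℕ} {R : Region} (hR : R.Closed) (hu : u ∈ R.vertices)
    (hv : v ∈ R.vertices) : ∃ Rs, RegionMove c m u v R Rs := by
  obtain ⟨S, B⟩ := R
  obtain ⟨b₁, hb₁, hu'⟩ := Region.mem_vertices.1 hu
  obtain ⟨b₂, hb₂, hv'⟩ := Region.mem_vertices.1 hv
  obtain ⟨B₁, rfl⟩ := Multiset.exists_cons_of_mem hb₁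
  obtain ⟨w₁, r₁⟩ := (hR b₁ hb₁).exists_reads hu'
  rcases Multiset.mem_cons.1 hb₂ with rfl | hb
  · obtain ⟨hw, hx⟩ := (hR b₂ hb₂).reads r₁
    obtain ⟨p, q, rfl, hp, -⟩ := exists_split_of_passes hw ((hx v).1 hv')
    -- The sphere split off takes none of the other boundaries; the second piece keeps the surface
    -- `S` and all of `B₁`, with directions unchanged.
    have := RegionMove.split (c := c) (m := m) S (.T 0) S S.sphere_connectedSum b₂ 0 B₁ 0 B₁ p q r₁
      hp (Reorient.refl _ _) (Reorient.refl _ _)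
    rw [zero_add] at this
    exact ⟨_, this⟩
  · obtain ⟨B₂, rfl⟩ := Multiset.exists_cons_of_mem hb
    obtain ⟨w₂, r₂⟩ := (hR b₂ hb₂).exists_reads hv'
    exact ⟨_, RegionMove.link S b₁ b₂ B₂ w₁ w₂ r₁ r₂⟩

/-! ## Game trees -/

namespace GameTree

theorem Equivalent.refl (A : GameTree) : A.Equivalent A := by
  induction A with
  | node ι f ih => exact ⟨fun i => ⟨i, ih i⟩, fun i => ⟨i, ih i⟩⟩

theorem Equivalent.symm {A B : GameTree} (h : A.Equivalent B) : B.Equivalent A := by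
  induction A generalizing B with
  | node ι f ih =>
    obtain ⟨κ, g⟩ := B
    exact ⟨fun j => (h.2 j).imp fun i hi => ih i hi, fun i => (h.1 i).imp fun j hj => ih i hj⟩

theorem Equivalent.trans {A B C : GameTree} (h : A.Equivalent B) (h' : B.Equivalent C) :
    A.Equivalent C := by
  induction A generalizing B C with
  | node ι f ih =>
    obtain ⟨κ, g⟩ := B
    obtain ⟨μ, k⟩ := C
    refine ⟨fun i => ?_, fun l => ?_⟩
    · obtain ⟨j, hj⟩ := h.1 i
      obtain ⟨l, hl⟩ := h'.1 j
      exact ⟨l, ih i hj hl⟩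
    · obtain ⟨j, hj⟩ := h'.2 l
      obtain ⟨i, hi⟩ := h.2 j
      exact ⟨i, ih i hi hj⟩

/-- Numbers of vertices are cardinals, hence well-ordered, so no finiteness of the tree is needed.
-/
theorem exists_isCanonical (A : GameTree) : ∃ T : GameTree, T.IsCanonical A := by
  obtain ⟨T, hT, hmin⟩ := (InvImage.wf numVertices Cardinal.lt_wf).has_min
    {T : GameTree | T.Equivalent A} ⟨A, Equivalent.refl A⟩
  exact ⟨T, hT, fun T' hT' => not_lt.1 (hmin T' hT')⟩

theorem IsCanonical.of_equivalent {T A B : GameTree} (hT : T.IsCanonical A)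
    (h : A.Equivalent B) : T.IsCanonical B :=
  ⟨hT.1.trans h, fun T' hT' => hT.2 T' (hT'.trans h.symm)⟩

end GameTree

namespace Position

theorem sameCanonicalTree_of_equivalent {G H : Position}
    (h : G.gameTree.Equivalent H.gameTree) : G.SameCanonicalTree H :=
  ⟨GameTree.exists_isCanonical _, fun _ => ⟨fun hT => hT.of_equivalent h,
    fun hT => hT.of_equivalent h.symm⟩⟩

/-- Positions related by a bisimulation have equivalent game trees. -/
theorem equivalent_of_bisimulation {r : Position → Position → Prop}
    (h₁ : ∀ G H G', r G H → G.Move G' → ∃ H', H.Move H' ∧ r G' H')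
    (h₂ : ∀ G H H', r G H → H.Move H' → ∃ G', G.Move G' ∧ r G' H')
    {G H : Position} (h : r G H) : G.gameTree.Equivalent H.gameTree := by
  -- Each move lowers the total number of lives, which bounds the depth of the game.
  induction hn : G.totalLives using Nat.strong_induction_on generalizing G H with
  | _ n ih =>
    subst hn
    rw [gameTree, gameTree]
    refine ⟨fun ⟨G', hG'⟩ => ?_, fun ⟨H', hH'⟩ => ?_⟩
    · obtain ⟨H', hH', hr⟩ := h₁ G H G' h hG'
      exact ⟨⟨H', hH'⟩, ih _ hG'.totalLives_lt hr rfl⟩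
    · obtain ⟨G', hG', hr⟩ := h₂ G H H' h hH'
      exact ⟨⟨G', hG'⟩, ih _ hG'.totalLives_lt hr rfl⟩

/-! ## The effect of a move on the lives -/

/-- The position obtained from `G` by drawing a line from `u` to `v`, with regions `Rs`. -/
def addLine (G : Position) (u v : ℕ) (Rs : Multiset Region) : Position :=
  ⟨G.numVertices + 1, G.edges ++ [(u, G.numVertices), (G.numVertices, v)], Rs⟩

theorem degree_addLine (G : Position) (u v : ℕ) (Rs : Multiset Region) (w : ℕ) :
    (G.addLine u v Rs).degree w = (if u = w then 1 else 0) + (if v = w then 1 else 0) +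
      (if G.numVertices = w then 2 else 0) + G.degree w := by
  simp only [degree, addLine, List.map_append, List.count_append, List.map_cons, List.map_nil,
    List.count_cons, List.count_nil, beq_iff_eq]
  split_ifs <;> omega

/-- An inequality is all that can be had here: nothing prevents the edges of an arbitrary `G` from
already using the number `G.numVertices`. -/
theorem lives_addLine_new (G : Position) (u v : ℕ) (Rs : Multiset Region) :
    (G.addLine u v Rs).lives G.numVertices ≤ 1 := by
  rw [lives, degree_addLine, if_pos rfl]
  omega

/-- `CanLink` guarantees one life per end of the line, two when both ends coincide, so the truncated
subtraction in `lives` loses nothing. -/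
theorem CanLink.lives_addLine {G : Position} {u v : ℕ} (h : G.CanLink u v) (Rs : Multiset Region)
    {w : ℕ} (hw : w < G.numVertices) :
    (G.addLine u v Rs).lives w + ((if u = w then 1 else 0) + (if v = w then 1 else 0)) =
      G.lives w := by
  obtain ⟨-, -, hlu, hlv, huv⟩ := h
  rw [lives, degree_addLine, if_neg hw.ne']
  unfold lives at *
  by_cases h1 : u = w <;> by_cases h2 : v = w
  · subst h1
    have := huv h2.symm
    simp only [h2, if_true]
    omega
  · subst h1
    simp only [h2, if_true, if_false]
    omega
  · subst h2
    simp only [h1, if_true, if_false]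
    omega
  · simp only [h1, h2, if_false]
    omega

/-- The total number of lives of the vertices touching a family of regions. -/
def familyLives (G : Position) (F : Multiset Region) : ℕ := ∑ v ∈ familyVertices F, G.lives v

theorem CanLink.sum_lives_addLine {G : Position} {u v : ℕ} (h : G.CanLink u v)
    (Rs : Multiset Region) {V : Finset ℕ} (hV : ∀ w ∈ V, w < G.numVertices) (hu : u ∈ V)
    (hv : v ∈ V) : ∑ w ∈ V, (G.addLine u v Rs).lives w + 2 = ∑ w ∈ V, G.lives w := by
  rw [← Finset.sum_congr rfl fun w hw => h.lives_addLine Rs (hV w hw), Finset.sum_add_distrib,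
    Finset.sum_add_distrib, Finset.sum_ite_eq, Finset.sum_ite_eq, if_pos hu, if_pos hv]

/-! ## Families of regions with few lives -/

/-- A family `F` of regions with at most three lives, in which any two live vertices touch a common
region, and which is made of one region only if there are three lives. -/
structure Tame (G : Position) (F : Multiset Region) : Prop where
  closed : ∀ R ∈ F, R.Closed
  lt : ∀ v ∈ familyVertices F, v < G.numVertices
  familyLives_le : G.familyLives F ≤ 3
  linkable : ∀ u ∈ familyVertices F, ∀ v ∈ familyVertices F, 1 ≤ G.lives u → 1 ≤ G.lives v →
    ∃ R ∈ F, u ∈ R.vertices ∧ v ∈ R.vertices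
  single : G.familyLives F ≤ 2 ∨ ∃ R, F = {R}

/-- A move outside a tame family leaves it tame. -/
theorem Tame.addLine {G : Position} {F : Multiset Region} (hF : G.Tame F) {u v : ℕ}
    (h : G.CanLink u v) (Rs : Multiset Region) : (G.addLine u v Rs).Tame F := by
  have hle : ∀ w ∈ familyVertices F, (G.addLine u v Rs).lives w ≤ G.lives w := fun w hw => by
    have := h.lives_addLine Rs (hF.lt w hw)
    omega
  have hs : (G.addLine u v Rs).familyLives F ≤ G.familyLives F := Finset.sum_le_sum hle
  exact ⟨hF.closed, fun w hw => (hF.lt w hw).trans (Nat.lt_succ_self _), hs.trans hF.familyLives_le,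
    fun x hx y hy h₁ h₂ => hF.linkable x hx y hy (h₁.trans (hle x hx)) (h₂.trans (hle y hy)),
    hF.single.imp_left hs.trans⟩

theorem mem_familyVertices_move {c u v : ℕ} {R : Region} {Rs F : Multiset Region}
    (h : MoveVertices c u v R Rs) (x : ℕ) :
    x ∈ familyVertices (Rs + F) ↔ x = c ∨ x ∈ familyVertices (R ::ₘ F) := by
  rw [mem_familyVertices_add, h.mem_iff, mem_familyVertices_cons, or_assoc]

/-- A move inside a region of a tame family leaves it tame. -/
theorem Tame.move {G : Position} {R : Region} {F : Multiset Region} (hF : G.Tame (R ::ₘ F))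
    {u v : ℕ} (h : G.CanLink u v) {Rs : Multiset Region}
    (hm : MoveVertices G.numVertices u v R Rs) (Rs' : Multiset Region) :
    (G.addLine u v Rs').Tame (Rs + F) := by
  set V := familyVertices (R ::ₘ F) with hVdef
  have hmem := mem_familyVertices_move (F := F) hm
  have hV : familyVertices (Rs + F) = insert G.numVertices V := by
    ext x
    rw [hmem, Finset.mem_insert]
  have hnew : G.numVertices ∉ V := fun hc => (hF.lt _ hc).false
  have hsum := h.sum_lives_addLine Rs' (V := V) hF.lt (mem_familyVertices_cons.2 (Or.inl hm.src_mem))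
    (mem_familyVertices_cons.2 (Or.inl hm.tgt_mem))
  have hc := G.lives_addLine_new u v Rs'
  have hle : ∑ w ∈ V, G.lives w ≤ 3 := hF.familyLives_le
  -- At most 3 - 2 lives are left on the old vertices, plus at most one on the new vertex.
  have hL : (G.addLine u v Rs').familyLives (Rs + F) ≤ 2 := by
    rw [familyLives, hV, Finset.sum_insert hnew]
    omega
  refine ⟨?_, ?_, hL.trans (by norm_num), ?_, Or.inl hL⟩
  · intro R' hR'
    rcases Multiset.mem_add.1 hR' with h' | h'
    · exact hm.closed R' h'
    · exact hF.closed R' (Multiset.mem_cons_of_mem h')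
  · intro x hx
    rcases (hmem x).1 hx with rfl | hx
    · exact Nat.lt_succ_self _
    · exact (hF.lt x hx).trans (Nat.lt_succ_self _)
  · have hself : ∀ x ∈ familyVertices (Rs + F), ∃ R' ∈ Rs + F, x ∈ R'.vertices ∧ x ∈ R'.vertices :=
      fun x hx => (mem_familyVertices.1 hx).imp fun _ h' => ⟨h'.1, h'.2, h'.2⟩
    -- A surviving old vertex must touch `R` itself: with at most two lives before the move none
    -- would survive, and otherwise `R` is the whole family. It then touches some piece of `R`, and
    -- every piece touches the new vertex.
    have hlink : ∀ x ∈ V, 1 ≤ (G.addLine u v Rs').lives x →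
        ∃ R' ∈ Rs + F, G.numVertices ∈ R'.vertices ∧ x ∈ R'.vertices := by
      intro x hx hlx
      have hx1 : (G.addLine u v Rs').lives x ≤ ∑ w ∈ V, (G.addLine u v Rs').lives w :=
        Finset.single_le_sum (f := (G.addLine u v Rs').lives) (fun _ _ => Nat.zero_le _) hx
      have hxR : x ∈ R.vertices := by
        rcases hF.single with h2 | ⟨R₀, h0⟩
        · have h2 : ∑ w ∈ V, G.lives w ≤ 2 := h2
          omega
        · obtain ⟨rfl, rfl⟩ : R = R₀ ∧ F = 0 := by
            have hF0 : F = 0 := by simpa using congrArg Multiset.card h0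
            subst hF0
            exact ⟨Multiset.singleton_inj.1 h0, rfl⟩
          simpa [hVdef, familyVertices_singleton] using hx
      obtain ⟨R', hR', hx'⟩ := mem_familyVertices.1 ((hm.mem_iff x).2 (Or.inr hxR))
      exact ⟨R', Multiset.mem_add.2 (Or.inl hR'), hm.new_mem R' hR', hx'⟩
    intro x hx y hy hlx hly
    by_cases hxy : x = y
    · subst hxy
      exact hself x hx
    rcases (hmem x).1 hx with rfl | hx'
    · rcases (hmem y).1 hy with rfl | hy'
      · exact absurd rfl hxy
      · exact hlink y hy' hly
    · rcases (hmem y).1 hy with rfl | hy'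
      · exact (hlink x hx' hlx).imp fun _ h' => ⟨h'.1, h'.2.2, h'.2.1⟩
      -- Two distinct old vertices cannot both be alive, since at most one old life remains.
      · have : (G.addLine u v Rs').lives x + (G.addLine u v Rs').lives y ≤
            ∑ w ∈ V, (G.addLine u v Rs').lives w :=
          Finset.add_le_sum (fun _ _ => Nat.zero_le _) hx' hy' hxy
        omega

/-! ### Similar positions and the bisimulation -/

/-- `G` and `H` differ only by their tame families `F` and `F'`, touched by the same vertices. -/
structure Similar (G H : Position) (F F' rest : Multiset Region) : Prop where
  regions_left : G.regions = F + rest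
  regions_right : H.regions = F' + rest
  numVertices_eq : G.numVertices = H.numVertices
  length_eq : G.edges.length = H.edges.length
  degree_eq : ∀ v, G.degree v = H.degree v
  vertices_eq : familyVertices F = familyVertices F'
  tame_left : G.Tame F
  tame_right : H.Tame F'

theorem Similar.symm {G H : Position} {F F' rest : Multiset Region} (h : G.Similar H F F' rest) :
    H.Similar G F' F rest :=
  ⟨h.regions_right, h.regions_left, h.numVertices_eq.symm, h.length_eq.symm,
    fun v => (h.degree_eq v).symm, h.vertices_eq.symm, h.tame_right, h.tame_left⟩

theorem Similar.canLink {G H : Position} {F F' rest : Multiset Region}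
    (h : G.Similar H F F' rest) {u v : ℕ} (huv : G.CanLink u v) : H.CanLink u v := by
  simpa only [CanLink, lives, h.numVertices_eq, h.degree_eq] using huv

/-- Two moves linking the same two vertices in tame families touched by the same vertices lead to
similar positions. -/
theorem Similar.move {G H : Position} {R R' : Region} {F F' rest : Multiset Region}
    (h : G.Similar H (R ::ₘ F) (R' ::ₘ F') rest) {u v u' v' : ℕ} (huv : s(u, v) = s(u', v'))
    (hG : G.CanLink u v) (hH : H.CanLink u' v') {Rs Rs' : Multiset Region}
    (hm : MoveVertices G.numVertices u v R Rs) (hm' : MoveVertices H.numVertices u' v' R' Rs') :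
    (G.addLine u v (Rs + (F + rest))).Similar (H.addLine u' v' (Rs' + (F' + rest)))
      (Rs + F) (Rs' + F') rest where
  regions_left := (add_assoc _ _ _).symm
  regions_right := (add_assoc _ _ _).symm
  numVertices_eq := congrArg (· + 1) h.numVertices_eq
  length_eq := by simp [addLine, h.length_eq]
  degree_eq w := by
    rw [degree_addLine, degree_addLine, h.numVertices_eq, h.degree_eq]
    rcases Sym2.eq_iff.1 huv with ⟨rfl, rfl⟩ | ⟨rfl, rfl⟩
    · rfl
    · omega
  vertices_eq := by
    ext x
    rw [mem_familyVertices_move hm, mem_familyVertices_move hm', h.vertices_eq, h.numVertices_eq]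
  tame_left := h.tame_left.move hG hm _
  tame_right := h.tame_right.move hH hm' _

/-- A move inside `F` is answered by any move of `F'` linking the same vertices, whatever its kind;
a move outside `F` is copied unchanged. Only the regions of `F` and `F'` need closed boundaries, so
the positions reached need not be shown to be embedded. -/
theorem Similar.exists_move {G H G' : Position} {F F' rest : Multiset Region}
    (h : G.Similar H F F' rest) (hG : G.Move G') :
    ∃ H', H.Move H' ∧ ∃ F₁ F₁' rest₁, G'.Similar H' F₁ F₁' rest₁ := by
  obtain ⟨R, u, v, rest₀, Rs, hreg, hlink, hmove, rfl⟩ := hG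
  have hlink' := h.canLink hlink
  have hR : R ∈ F + rest := by
    rw [← h.regions_left, hreg]
    exact Multiset.mem_cons_self _ _
  rcases Multiset.mem_add.1 hR with hR | hR
  · obtain ⟨F₀, rfl⟩ := Multiset.exists_cons_of_mem hR
    obtain rfl : rest₀ = F₀ + rest := by
      simpa [hreg, Multiset.cons_add] using h.regions_left
    have hmv := hmove.moveVertices (h.tame_left.closed R hR)
    have hmemu : u ∈ familyVertices F' :=
      h.vertices_eq ▸ mem_familyVertices_cons.2 (Or.inl hmv.src_mem)
    have hmemv : v ∈ familyVertices F' :=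
      h.vertices_eq ▸ mem_familyVertices_cons.2 (Or.inl hmv.tgt_mem)
    obtain ⟨R', hR', hu, hv⟩ := h.tame_right.linkable u hmemu v hmemv hlink'.2.2.1 hlink'.2.2.2.1
    obtain ⟨F₀', rfl⟩ := Multiset.exists_cons_of_mem hR'
    have hcl := h.tame_right.closed R' hR'
    obtain ⟨Rs', hmove'⟩ := exists_regionMove H.numVertices H.edges.length hcl hu hv
    exact ⟨H.addLine u v (Rs' + (F₀' + rest)),
      ⟨R', u, v, F₀' + rest, Rs', by rw [h.regions_right, Multiset.cons_add], hlink', hmove', rfl⟩,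
      _, _, _, h.move rfl hlink hlink' hmv (hmove'.moveVertices hcl)⟩
  · obtain ⟨rest₁, rfl⟩ := Multiset.exists_cons_of_mem hR
    obtain rfl : rest₀ = F + rest₁ := by
      simpa [hreg, Multiset.add_cons] using h.regions_left
    refine ⟨H.addLine u v (Rs + (F' + rest₁)),
      ⟨R, u, v, F' + rest₁, Rs, by rw [h.regions_right, Multiset.add_cons], hlink', ?_, rfl⟩,
      F, F', Rs + rest₁, add_left_comm _ _ _, add_left_comm _ _ _,
      congrArg (· + 1) h.numVertices_eq, by simp [addLine, h.length_eq], fun w => ?_,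
      h.vertices_eq, h.tame_left.addLine hlink _, h.tame_right.addLine hlink' _⟩
    -- The copied move names its new vertex and edges by number, so both positions must number them
    -- alike.
    · rwa [← h.numVertices_eq, ← h.length_eq]
    · exact (degree_addLine G u v (Rs + (F + rest₁)) w).trans
        (by rw [degree_addLine, h.numVertices_eq, h.degree_eq])

theorem Similar.sameCanonicalTree {G H : Position} {F F' rest : Multiset Region}
    (h : G.Similar H F F' rest) : G.SameCanonicalTree H := by
  refine sameCanonicalTree_of_equivalent (equivalent_of_bisimulation
    (r := fun G H => ∃ F F' rest, G.Similar H F F' rest) ?_ ?_ ⟨F, F', rest, h⟩)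
  · rintro G H G' ⟨F, F', rest, h⟩ hG
    exact h.exists_move hG
  · rintro G H H' ⟨F, F', rest, h⟩ hH
    obtain ⟨G', hG', F₁, F₁', rest₁, h₁⟩ := h.symm.exists_move hH
    exact ⟨G', hG', F₁', F₁, rest₁, h₁.symm⟩

/-! ## Moves inside one region -/

theorem familyLives_singleton (G : Position) (R : Region) :
    G.familyLives {R} = G.regionLives R := by
  rw [familyLives, familyVertices_singleton, regionLives]

/-- The bound of three lives enters the argument here; a single region is trivially common to all
its vertices. -/
theorem tame_singleton {G : Position} {R : Region} (hR : R.Closed)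
    (hlt : ∀ v ∈ R.vertices, v < G.numVertices) (hl : G.regionLives R ≤ 3) : G.Tame {R} where
  closed R' hR' := by rwa [Multiset.mem_singleton.1 hR']
  lt := by rwa [familyVertices_singleton]
  familyLives_le := by rwa [familyLives_singleton]
  linkable u hu v hv _ _ := by
    rw [familyVertices_singleton] at hu hv
    exact ⟨R, Multiset.mem_singleton_self R, hu, hv⟩
  single := Or.inr ⟨R, rfl⟩

theorem IsEmbedded.closed {G : Position} (hG : G.IsEmbedded) {R : Region} (hR : R ∈ G.regions) :
    R.Closed :=
  fun b hb => hG.isWalk b (Multiset.mem_bind.2 ⟨R, hR, hb⟩)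

theorem IsEmbedded.vertices_lt {G : Position} (hG : G.IsEmbedded) {R : Region}
    (hR : R ∈ G.regions) {v : ℕ} (hv : v ∈ R.vertices) : v < G.numVertices := by
  obtain ⟨b, hb, hv⟩ := Region.mem_vertices.1 hv
  have hb' : b ∈ G.allBoundaries := Multiset.mem_bind.2 ⟨R, hR, hb⟩
  obtain rfl | ⟨d, hd, rfl⟩ : v = b.base ∨ ∃ d ∈ b.walk, d.src = v := by
    simpa [Boundary.vertices] using hv
  · exact hG.base_lt b hb'
  · have h := hG.edges_lt _ (List.mem_of_getElem? (hG.hasDart b hb' d hd))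
    split_ifs at h
    exacts [h.1, h.2]

theorem CanLink.two_le_sum {G : Position} {u v : ℕ} (h : G.CanLink u v) {V : Finset ℕ}
    (hV : ∀ w ∈ V, w < G.numVertices) (hu : u ∈ V) (hv : v ∈ V) : 2 ≤ ∑ w ∈ V, G.lives w := by
  -- Lives depend on the edges only, so the empty family `0` serves as a dummy list of regions.
  have := h.sum_lives_addLine 0 hV hu hv
  omega

/-- If the vertices of `V` have two lives in all, one pair of vertices of `V` only can be linked. -/
theorem exists_unique_canLink {G : Position} {V : Finset ℕ} (hV : ∀ w ∈ V, w < G.numVertices)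
    (h2 : ∑ w ∈ V, G.lives w = 2) : ∃ u ∈ V, ∃ v ∈ V, G.CanLink u v ∧
      ∀ u' ∈ V, ∀ v' ∈ V, G.CanLink u' v' → s(u', v') = s(u, v) := by
  have hex : ∃ u ∈ V, ∃ v ∈ V, G.CanLink u v := by
    obtain ⟨u, hu, hlu⟩ : ∃ u ∈ V, G.lives u ≠ 0 :=
      Finset.exists_ne_zero_of_sum_ne_zero (by omega)
    have hsplit := Finset.add_sum_erase V G.lives hu
    by_cases h : 2 ≤ G.lives u
    · exact ⟨u, hu, u, hu, hV u hu, hV u hu, by omega, by omega, fun _ => h⟩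
    · obtain ⟨v, hv, hlv⟩ : ∃ v ∈ V.erase u, G.lives v ≠ 0 :=
        Finset.exists_ne_zero_of_sum_ne_zero (by omega)
      have hne := Finset.ne_of_mem_erase hv
      have hv := Finset.mem_of_mem_erase hv
      exact ⟨u, hu, v, hv, hV u hu, hV v hv, by omega, by omega, fun e => absurd e.symm hne⟩
  obtain ⟨u, hu, v, hv, h⟩ := hex
  refine ⟨u, hu, v, hv, h, fun u' hu' v' hv' h' => ?_⟩
  -- The line from `u` to `v` uses up both lives, so the lives of each `w` equal the number of its
  -- ends at `w`. This determines every linkable pair.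
  have hzero : ∀ w ∈ V, (if u = w then 1 else 0) + (if v = w then 1 else 0) = G.lives w := by
    intro w hw
    have hs := h.sum_lives_addLine 0 hV hu hv
    have hw0 : (G.addLine u v 0).lives w = 0 :=
      Finset.sum_eq_zero_iff.1 (by omega : ∑ w ∈ V, (G.addLine u v 0).lives w = 0) w hw
    have := h.lives_addLine 0 (hV w hw)
    omega
  obtain ⟨-, -, h₁, h₂, h₃⟩ := h'
  rw [← hzero u' hu'] at h₁ h₃
  rw [← hzero v' hv'] at h₂
  rw [Sym2.eq_iff]
  grind

/-- `G` is similar to itself with `{R}` as tame family on both sides; the two moves are then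
matching moves of this pair. -/
theorem MoveIn.similar {G : Position} (hG : G.IsEmbedded) {R : Region}
    (hl : G.regionLives R ≤ 3) {u₁ v₁ u₂ v₂ : ℕ} {H₁ H₂ : Position} (huv : s(u₁, v₁) = s(u₂, v₂))
    (h₁ : G.MoveIn R u₁ v₁ H₁) (h₂ : G.MoveIn R u₂ v₂ H₂) :
    ∃ F F' rest, H₁.Similar H₂ F F' rest := by
  obtain ⟨rest, Rs₁, hreg, hlink₁, hm₁, rfl⟩ := h₁
  obtain ⟨rest', Rs₂, hreg', hlink₂, hm₂, rfl⟩ := h₂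
  obtain rfl : rest = rest' := by simpa [hreg] using hreg'
  have hR : R ∈ G.regions := hreg ▸ Multiset.mem_cons_self R rest
  have hcl := hG.closed hR
  have ht : G.Tame (R ::ₘ 0) := tame_singleton hcl (fun _ => hG.vertices_lt hR) hl
  have hs : G.Similar G (R ::ₘ 0) (R ::ₘ 0) rest :=
    ⟨by simp [hreg], by simp [hreg], rfl, rfl, fun _ => rfl, rfl, ht, ht⟩
  have := hs.move huv hlink₁ hlink₂ (hm₁.moveVertices hcl) (hm₂.moveVertices hcl)
  rw [zero_add] at this
  exact ⟨_, _, _, this⟩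

end Position

end Sprouts

/-! ### The four claims -/

theorem mainTheorem2 (G : Sprouts.Position) (hG : G.IsEmbedded)
    (R : Sprouts.Region) (rest : Multiset Sprouts.Region) (hR : G.regions = R ::ₘ rest)
    (hlives : G.regionLives R ≤ 3) :
    (∀ R' : Sprouts.Region, Sprouts.Reorient R.surface R.boundaries R'.boundaries →
      G.SameCanonicalTree ⟨G.numVertices, G.edges, R' ::ₘ rest⟩) ∧
    (G.regionLives R ≤ 1 → ∀ u v H, ¬ G.MoveIn R u v H) ∧
    (G.regionLives R = 2 → ∃ u v, (∃ H, G.MoveIn R u v H) ∧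
      (∀ u' v' H, G.MoveIn R u' v' H → s(u', v') = s(u, v)) ∧
      (∀ u₁ v₁ u₂ v₂ H₁ H₂, G.MoveIn R u₁ v₁ H₁ → G.MoveIn R u₂ v₂ H₂ →
        H₁.SameCanonicalTree H₂)) ∧
    (G.regionLives R = 3 → ∀ u₁ v₁ u₂ v₂ H₁ H₂, s(u₁, v₁) = s(u₂, v₂) →
      G.MoveIn R u₁ v₁ H₁ → G.MoveIn R u₂ v₂ H₂ → H₁.SameCanonicalTree H₂) := by
  have hRG : R ∈ G.regions := hR ▸ Multiset.mem_cons_self R rest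
  have hcl := hG.closed hRG
  have hlt : ∀ v ∈ R.vertices, v < G.numVertices := fun v hv => hG.vertices_lt hRG hv
  have hmem : ∀ {u v H}, G.MoveIn R u v H →
      u ∈ R.vertices ∧ v ∈ R.vertices ∧ G.CanLink u v := by
    rintro u v H ⟨_, _, -, hlink, hm, -⟩
    have := hm.moveVertices hcl
    exact ⟨this.src_mem, this.tgt_mem, hlink⟩
  have hsame : ∀ u₁ v₁ u₂ v₂ H₁ H₂, s(u₁, v₁) = s(u₂, v₂) →
      G.MoveIn R u₁ v₁ H₁ → G.MoveIn R u₂ v₂ H₂ → H₁.SameCanonicalTree H₂ := by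
    intro u₁ v₁ u₂ v₂ H₁ H₂ huv h₁ h₂
    obtain ⟨_, _, _, h⟩ := Sprouts.Position.MoveIn.similar hG hlives huv h₁ h₂
    exact h.sameCanonicalTree
  refine ⟨fun R' hR' => ?_, fun h1 u v H h => ?_, fun h2 => ?_, fun _ => hsame⟩
  -- Reversing boundaries keeps their vertices, and the surface plays no part in `Tame`; hence `{R}`
  -- and `{R'}` are interchangeable tame families.
  · have hv : R'.vertices = R.vertices := by
      ext x
      rw [Sprouts.Region.mem_vertices, Sprouts.Region.mem_vertices]
      exact hR'.mem_vertices hcl x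
    have ht := Sprouts.Position.tame_singleton hcl hlt hlives
    have ht' : Sprouts.Position.Tame ⟨G.numVertices, G.edges, R' ::ₘ rest⟩ {R'} :=
      Sprouts.Position.tame_singleton (hR'.closed hcl) (by rwa [hv])
        (by rw [Sprouts.Position.regionLives, hv]; exact hlives)
    exact Sprouts.Position.Similar.sameCanonicalTree (F := {R}) (F' := {R'}) (rest := rest)
      ⟨hR, rfl, rfl, rfl, fun _ => rfl,
        by rw [Sprouts.familyVertices_singleton, Sprouts.familyVertices_singleton, hv], ht, ht'⟩
  · obtain ⟨hu, hv, hlink⟩ := hmem h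
    have := hlink.two_le_sum hlt hu hv
    have h1 : ∑ w ∈ R.vertices, G.lives w ≤ 1 := h1
    omega
  · obtain ⟨u, hu, v, hv, hlink, huniq⟩ := Sprouts.Position.exists_unique_canLink hlt h2
    have hpair : ∀ u' v' H, G.MoveIn R u' v' H → s(u', v') = s(u, v) := by
      intro u' v' H h
      obtain ⟨hu', hv', hlink'⟩ := hmem h
      exact huniq u' hu' v' hv' hlink'
    obtain ⟨Rs, hm⟩ := Sprouts.exists_regionMove G.numVertices G.edges.length hcl hu hv
    exact ⟨u, v, ⟨_, rest, Rs, hR, hlink, hm, rfl⟩, hpair, fun u₁ v₁ u₂ v₂ H₁ H₂ h₁ h₂ =>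
      hsame u₁ v₁ u₂ v₂ H₁ H₂ ((hpair _ _ _ h₁).trans (hpair _ _ _ h₂).symm) h₁ h₂⟩
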